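/- Let $[n]=\{1,\dots,n\}$ and let the grid $[n]^2$ be the graph in which two distinct vertices are adjacent if each coordinate differs by at most $1$ (so distances are $\ell_\infty$ distances). In the game Catching a Fast Robber with $k$ cops and a robber of speed $2$, played with perfect information, the cops first choose their starting vertices, then the robber chooses his; after that the two sides move alternately, the cops going first. On the cops' turn each cop stays put or moves to an adjacent vertex; on his turn the robber moves to any vertex at distance at most $2$ from his current one (possibly staying put). The robber is caught if at some point a cop is on the same vertex as the robber. We say that $k$ cops can catch the robber if they have a strategy that catches the robber after finitely many turns, however he plays. Then there are absolute constants $C>0$ and $N$ such that for every $n\ge N$ there is an integer $k\le C\,n^{0.999}$ for which $k$ cops can catch a robber of speed $2$ on the grid $[n]^2$. In other words, $O(n^{0.999})$ cops can catch a robber of speed $2$ on $[n]^2$ for $n$ sufficiently large. -/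

import Mathlib

/-- The grid `[n]²` with the `ℓ_∞` distance: two distinct vertices are adjacent
when each coordinate differs by at most `1`. -/
def gridGraph (n : ℕ) : SimpleGraph (Fin n × Fin n) where
  Adj p q := p ≠ q ∧ |(p.1 : ℤ) - (q.1 : ℤ)| ≤ 1 ∧ |(p.2 : ℤ) - (q.2 : ℤ)| ≤ 1
  symm := ⟨fun p q h => ⟨h.1.symm, by rw [abs_sub_comm]; exact h.2.1,
    by rw [abs_sub_comm]; exact h.2.2⟩⟩
  loopless := ⟨fun _ h => h.1 rfl⟩

namespace FastRobber

variable {V : Type*}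

/-- A (perfect information) strategy for `k` cops on the graph `G`. The list is the list of all
positions that the robber has occupied so far, the most recent one first, and `pos h i` is the
vertex on which cop `i` stands once the cops have responded to `h`. So `pos []` is the starting
configuration, chosen before the robber is placed. On each cops' turn every cop stays put or moves
to an adjacent vertex. -/
structure CopStrategy (G : SimpleGraph V) (k : ℕ) where
  pos : List V → Fin k → V
  legal : ∀ (h : List V) (v : V) (i : Fin k),
    pos (v :: h) i = pos h i ∨ G.Adj (pos h i) (pos (v :: h) i)

/-- The list `[r (t-1), …, r 1, r 0]` of the first `t` positions of the robber, most recent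
first. -/
def history (r : ℕ → V) : ℕ → List V
  | 0 => []
  | t + 1 => r t :: history r t

/-- A legal trajectory of a robber of speed `s`: he starts anywhere, and on each of his turns he
moves to a vertex at distance at most `s` from his current one. -/
def IsRobberPlay (G : SimpleGraph V) (s : ℕ) (r : ℕ → V) : Prop :=
  ∀ t : ℕ, G.edist (r t) (r (t + 1)) ≤ (s : ℕ∞)

/-- The cops catch the robber who plays `r`: at some point a cop is on the robber's vertex. While
the robber is on `r t`, the cops first stand on `pos (history r t)` (when he has just arrived
there), and then, after their next turn, on `pos (history r (t + 1))`. -/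
def CopStrategy.Catches {G : SimpleGraph V} {k : ℕ} (σ : CopStrategy G k) (r : ℕ → V) : Prop :=
  ∃ (t : ℕ) (i : Fin k), σ.pos (history r t) i = r t ∨ σ.pos (history r (t + 1)) i = r t

/-- `k` cops (of speed `1`) can catch a robber of speed `s` on `G`: the cops have a strategy that
catches the robber however he plays. -/
def CopsCanCatch (G : SimpleGraph V) (s k : ℕ) : Prop :=
  ∃ σ : CopStrategy G k, ∀ r : ℕ → V, IsRobberPlay G s r → σ.Catches r

end FastRobber

namespace FastRobber

/-! In the coordinates `u = x + y`, `v = x - y` a robber's move satisfies `|Δu| + |Δv| ≤ 4`. A row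
of immobile cops on a diagonal is a fence, at linear cost; the gain comes from letting one gadget
guard two places. Take 179 small fences along `v = 0`, and 101 reflected ones along `u = 0` as a
needle. A robber on one side of the needle threatens only that half of the row, and reaching the
other half means walking around the needle's tip. That detour is long enough for a gadget of speed 1
to move from its home in one half to its home in the other. The needle is served in the same way,
with the row as obstacle. So 147 gadgets yield a fence 178 times as large (`IsGuard.exists_step`),
and by iteration a fence of scale `8 * 178 ^ k` costs `13 * 147 ^ k` cops (`exists_guard`).
Positions depend only on the robber's current position, so the two families can rely on each other
without circularity: each step is analysed for a robber who has so far avoided the whole fence.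

Boundedly many such fences form a mesh that shrinks the robber's region by the factor 178
(`Confines.refine`). Summing over scales costs `O(147 ^ J)` with `178 ^ J ≤ 178 * n`, and `log 147 /
log 178 < 0.999`. -/

/-- `X` and `Y` are at `ℓ_∞` distance at most `r`. -/
def Within (r : ℤ) (X Y : ℤ × ℤ) : Prop := |X.1 - Y.1| ≤ r ∧ |X.2 - Y.2| ≤ r

theorem within_iff {r : ℤ} {X Y : ℤ × ℤ} : Within r X Y ↔
    (-r ≤ X.1 - Y.1 ∧ X.1 - Y.1 ≤ r) ∧ (-r ≤ X.2 - Y.2 ∧ X.2 - Y.2 ≤ r) := by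
  simp only [Within, abs_le]

/-! ### Motion of a gadget with two homes -/

/-- A diagonal coordinate, signed distance to the vertical diagonal `x + y = 0`, lengthened below
height `H` by the detour around the tip of a needle of height `H`. -/
def detour (H : ℤ) (X : ℤ × ℤ) : ℤ :=
  if X.1 + X.2 < 0 then X.1 + X.2 - max 0 (min (H - (X.1 - X.2)) (H + (X.1 - X.2)))
  else X.1 + X.2 + max 0 (min (H - (X.1 - X.2)) (H + (X.1 - X.2)))

/-- Away from the cut this is `|Δu| + |Δv| ≤ 4`. The jump at `u = 0` has size `2 * max 0 (H - |v|)`,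
which vanishes where `hcut` permits a crossing. -/
theorem detour_lip {H : ℤ} {X Y : ℤ × ℤ} (h : Within 2 X Y)
    (hcut : (X.1 + X.2 < 0 ↔ Y.1 + Y.2 < 0) ∨ (H ≤ |X.1 - X.2| ∧ H ≤ |Y.1 - Y.2|)) :
    -4 ≤ detour H X - detour H Y ∧ detour H X - detour H Y ≤ 4 := by
  obtain ⟨x, y⟩ := X
  obtain ⟨x', y'⟩ := Y
  rw [within_iff] at h
  simp only [detour, le_abs] at *
  rcases hcut with hc | ⟨h1, h2⟩
  · split_ifs <;> omega
  · split_ifs <;> omega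

/-- How far a gadget has moved along the diagonal when the robber is at `X`. -/
def shift (σ N z H : ℤ) (X : ℤ × ℤ) : ℤ :=
  max 0 (min N (min ((detour H X + 2 * z - 6 * σ + H) / 4)
    ((356 * σ - max (max X.1 (-X.1)) (max X.2 (-X.2))) / 2)))

section shift

variable {σ N z H : ℤ} {X Y : ℤ × ℤ}

theorem shift_nonneg : 0 ≤ shift σ N z H X := le_max_left _ _

/-- The divisors 4 and 2 are the maximal changes per move of `detour` and of the sup norm, so both
quotients have speed 1. The second quotient sends the gadget back to its base when the robber is
far. -/
theorem shift_lip (h : Within 2 X Y)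
    (hcut : (X.1 + X.2 < 0 ↔ Y.1 + Y.2 < 0) ∨ (H ≤ |X.1 - X.2| ∧ H ≤ |Y.1 - Y.2|)) :
    -1 ≤ shift σ N z H X - shift σ N z H Y ∧ shift σ N z H X - shift σ N z H Y ≤ 1 := by
  have hd := detour_lip h hcut
  rw [within_iff] at h
  unfold shift
  generalize detour H X = g at *
  generalize detour H Y = g' at *
  have h1 : (g + 2 * z - 6 * σ + H) / 4 ≤ (g' + 2 * z - 6 * σ + H) / 4 + 1 ∧
      (g' + 2 * z - 6 * σ + H) / 4 ≤ (g + 2 * z - 6 * σ + H) / 4 + 1 := by omega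
  have h2 : max (max X.1 (-X.1)) (max X.2 (-X.2)) ≤ max (max Y.1 (-Y.1)) (max Y.2 (-Y.2)) + 2 ∧
      max (max Y.1 (-Y.1)) (max Y.2 (-Y.2)) ≤ max (max X.1 (-X.1)) (max X.2 (-X.2)) + 2 := by omega
  generalize (g + 2 * z - 6 * σ + H) / 4 = a at *
  generalize (g' + 2 * z - 6 * σ + H) / 4 = a' at *
  generalize max (max X.1 (-X.1)) (max X.2 (-X.2)) = b at *
  generalize max (max Y.1 (-Y.1)) (max Y.2 (-Y.2)) = b' at *
  omega

/-- Here `u < 0` and `u + |v| ≤ -2z + 6σ`, while `detour + H ≤ u + |v|`; this is where the offset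
`-6σ` comes from. -/
theorem shift_eq_zero_of_near (hσ : 4 ≤ σ) (hz : 4 * σ ≤ z)
    (h : Within (3 * σ) X (-z, -z)) : shift σ N z H X = 0 := by
  obtain ⟨x, y⟩ := X
  rw [within_iff] at h
  simp only at h
  have hg : detour H (x, y) + 2 * z - 6 * σ + H ≤ 0 := by
    simp only [detour]
    split_ifs <;> omega
  unfold shift
  omega

theorem shift_eq_of_near (hσ : 4 ≤ σ) (hz : 4 * σ ≤ z) (hzN : z + 4 * σ ≤ N) (hN : N ≤ 93 * σ)
    (hH : N + 7 * σ ≤ H) (h : Within (3 * σ) X (N - z, N - z)) : shift σ N z H X = N := by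
  obtain ⟨x, y⟩ := X
  rw [within_iff] at h
  simp only at h
  have hg : 4 * N ≤ detour H (x, y) + 2 * z - 6 * σ + H := by
    simp only [detour]
    split_ifs <;> omega
  have hf : 2 * N ≤ 356 * σ - max (max x (-x)) (max y (-y)) := by omega
  unfold shift
  simp only
  omega

/-- A gadget in transit, at shift `n`, is never near the robber. If it were, `|u - 2(n - z)| + |v| ≤
6σ`. For `u < 0` the numerator of the first quotient is at most `2n < 4n`. For `u ≥ 0` it is at
least `2n - 12σ + 2H ≥ 4n + 4`, by `H ≥ N + 7σ`. The norm cap is not active that close to the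
diagonal segment. -/
theorem shift_of_near_pose (hσ : 4 ≤ σ) (hz : 4 * σ ≤ z) (hzN : z + 4 * σ ≤ N) (hN : N ≤ 93 * σ)
    (hH : N + 7 * σ ≤ H)
    (h : Within (3 * σ) X (shift σ N z H X - z, shift σ N z H X - z)) :
    shift σ N z H X = 0 ∨ shift σ N z H X = N := by
  obtain ⟨x, y⟩ := X
  rw [within_iff] at h
  simp only at h
  by_contra hcon
  have h0 : 0 ≤ shift σ N z H (x, y) := shift_nonneg
  have h1 : shift σ N z H (x, y) ≤ N := by
    unfold shift; omega
  have h2 : 4 * shift σ N z H (x, y) ≤ detour H (x, y) + 2 * z - 6 * σ + H := by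
    unfold shift at *; simp only at *; omega
  have h3 : detour H (x, y) + 2 * z - 6 * σ + H < 4 * shift σ N z H (x, y) + 4 ∨
      356 * σ - max (max x (-x)) (max y (-y)) < 2 * shift σ N z H (x, y) + 2 := by
    unfold shift at *; simp only at *; omega
  generalize shift σ N z H (x, y) = n at *
  simp only [detour] at *
  rcases h3 with h3 | h3
  · split_ifs at * <;> omega
  · omega

theorem shift_eq_zero_of_far (h : ¬ Within (356 * σ) X 0) : shift σ N z H X = 0 := by
  obtain ⟨x, y⟩ := X
  rw [within_iff] at h
  simp only [Prod.fst_zero, Prod.snd_zero, sub_zero] at h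
  have : 356 * σ - max (max x (-x)) (max y (-y)) ≤ 0 := by omega
  unfold shift
  simp only
  omega

end shift

theorem Within.mono {r s : ℤ} {X Y : ℤ × ℤ} (h : Within r X Y) (hrs : r ≤ s) : Within s X Y :=
  ⟨h.1.trans hrs, h.2.trans hrs⟩

theorem Within.symm {r : ℤ} {X Y : ℤ × ℤ} (h : Within r X Y) : Within r Y X := by
  rw [within_iff] at *
  omega

theorem Within.trans {r s : ℤ} {X Y Z : ℤ × ℤ} (h : Within r X Y) (h' : Within s Y Z) :
    Within (r + s) X Z := by
  rw [within_iff] at *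
  omega

theorem within_sub_right {r : ℤ} {X Y c : ℤ × ℤ} : Within r (X - c) (Y - c) ↔ Within r X Y := by
  simp only [within_iff, Prod.fst_sub, Prod.snd_sub]
  omega

theorem within_add_right {r : ℤ} {X Y c : ℤ × ℤ} : Within r (X + c) (Y + c) ↔ Within r X Y := by
  simp only [within_iff, Prod.fst_add, Prod.snd_add]
  omega

theorem within_add_left {r : ℤ} {X Y c : ℤ × ℤ} : Within r (c + X) (c + Y) ↔ Within r X Y := by
  simp only [within_iff, Prod.fst_add, Prod.snd_add]
  omega

theorem within_add_left_iff_sub {r : ℤ} {X Y c : ℤ × ℤ} :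
    Within r (c + X) Y ↔ Within r X (Y - c) := by
  simp only [within_iff, Prod.fst_add, Prod.snd_add, Prod.fst_sub, Prod.snd_sub]
  omega

theorem within_sub_zero {r : ℤ} {X c : ℤ × ℤ} : Within r (X - c) 0 ↔ Within r X c := by
  simp only [within_iff, Prod.fst_sub, Prod.snd_sub, Prod.fst_zero, Prod.snd_zero]
  omega

/-! ### Guards, separation and the base case -/

/-- A memoryless gadget of radius `2 * σ` in `ℤ²`: a family of cops, whose positions `cop i X`
depend only on the current position `X` of the robber, that move with speed `1` as long as a robber
of speed `2` stays outside of `W`, that catch him when he steps into `W`, and that are at rest when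
he is far away. -/
structure IsGuard {ι : Type*} (σ : ℤ) (W : Set (ℤ × ℤ)) (cop : ι → ℤ × ℤ → ℤ × ℤ)
    (rest : ι → ℤ × ℤ) : Prop where
  lip : ∀ X Y, Within 2 X Y → X ∉ W → Y ∉ W → ∀ i, Within 1 (cop i X) (cop i Y)
  catches : ∀ X Y, Within 2 X Y → X ∉ W → Y ∈ W → ∃ i, Within 1 (cop i X) Y
  far : ∀ X, ¬ Within (2 * σ) X 0 → ∀ i, cop i X = rest i
  near : ∀ X ∈ W, Within (2 * σ) X 0

/-- A robber of speed `2` who avoids `W` cannot cross the line `x = y` near the origin. -/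
def Separates (σ : ℤ) (W : Set (ℤ × ℤ)) : Prop :=
  ∀ X Y, Within 2 X Y → X ∉ W → Y ∉ W → |X.1 + X.2| ≤ σ + 4 → |Y.1 + Y.2| ≤ σ + 4 →
    (0 < X.1 - X.2 ∧ 0 < Y.1 - Y.2) ∨ (X.1 - X.2 < 0 ∧ Y.1 - Y.2 < 0)

/-- Reflection in the first axis; it exchanges the two diagonals. -/
def flip (X : ℤ × ℤ) : ℤ × ℤ := (X.1, -X.2)

@[simp] theorem flip_fst (X : ℤ × ℤ) : (flip X).1 = X.1 := rfl

@[simp] theorem flip_snd (X : ℤ × ℤ) : (flip X).2 = -X.2 := rfl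

@[simp] theorem flip_flip (X : ℤ × ℤ) : flip (flip X) = X := by simp [flip]

theorem flip_sub (X Y : ℤ × ℤ) : flip (X - Y) = flip X - flip Y := by
  ext
  · rfl
  · simp only [flip_snd, Prod.snd_sub]
    omega

theorem within_flip {r : ℤ} {X Y : ℤ × ℤ} : Within r (flip X) (flip Y) ↔ Within r X Y := by
  simp only [within_iff, flip_fst, flip_snd]
  omega

theorem within_flip_left {r : ℤ} {X Y : ℤ × ℤ} : Within r (flip X) Y ↔ Within r X (flip Y) := by
  rw [← within_flip, flip_flip]

theorem within_flip_zero {r : ℤ} {X : ℤ × ℤ} : Within r (flip X) 0 ↔ Within r X 0 := by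
  simp only [within_iff, flip_fst, flip_snd, Prod.fst_zero, Prod.snd_zero]
  omega

theorem IsGuard.reflect {ι : Type*} {σ : ℤ} {W : Set (ℤ × ℤ)} {cop : ι → ℤ × ℤ → ℤ × ℤ}
    {rest : ι → ℤ × ℤ} (G : IsGuard σ W cop rest) :
    IsGuard σ (flip ⁻¹' W) (fun i X => flip (cop i (flip X))) (fun i => flip (rest i)) where
  lip X Y h hX hY i := within_flip.2 (G.lip _ _ (within_flip.2 h) hX hY i)
  catches X Y h hX hY := by
    obtain ⟨i, hi⟩ := G.catches _ _ (within_flip.2 h) hX hY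
    exact ⟨i, within_flip_left.2 hi⟩
  far X h i := by rw [G.far _ (fun h' => h (within_flip_zero.1 h'))]
  near X h := within_flip_zero.1 (G.near _ h)

/-- Thirteen immobile cops on the diagonal. -/
theorem exists_guard_base : ∃ (W : Set (ℤ × ℤ)) (cop : Fin 13 → ℤ × ℤ → ℤ × ℤ)
    (rest : Fin 13 → ℤ × ℤ), IsGuard 8 W cop rest ∧ Separates 8 W := by
  refine ⟨{X | ∃ i : Fin 13, Within 1 ((i : ℤ) - 6, (i : ℤ) - 6) X},
    fun i _ => ((i : ℤ) - 6, (i : ℤ) - 6), fun i => ((i : ℤ) - 6, (i : ℤ) - 6),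
    ⟨?_, fun X Y _ _ h => h, fun _ _ _ => rfl, ?_⟩, ?_⟩
  · intro X Y _ _ _ i
    simp [Within]
  · rintro X ⟨i, hi⟩
    have := i.2
    simp only [within_iff, Prod.fst_zero, Prod.snd_zero] at *
    omega
  · intro X Y h hX hY hXu hYu
    -- The cops' neighbourhoods fill the strip `|v| ≤ 2` for `|u| ≤ 12`, and one move changes `v` by
    -- at most 4, too little to jump from `v ≥ 3` to `v ≤ -3`.
    have key : ∀ X : ℤ × ℤ, X ∉ {X | ∃ i : Fin 13, Within 1 ((i : ℤ) - 6, (i : ℤ) - 6) X} →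
        |X.1 + X.2| ≤ 8 + 4 → 3 ≤ X.1 - X.2 ∨ X.1 - X.2 ≤ -3 := by
      intro X hX hu
      rw [abs_le] at hu
      by_contra hcon
      refine hX ⟨⟨((X.1 + X.2) / 2 + 6).toNat, by omega⟩, ?_⟩
      simp only [within_iff]
      omega
    have h1 := key X hX hXu
    have h2 := key Y hY hYu
    rw [within_iff] at h
    omega

/-! ### The recursive construction -/

/-- A way of moving a gadget about, depending on the position `X` of a robber who avoids `A`: the
gadget moves with speed `1`, it sits at `c ∈ homes` when the robber is near `c`, and when the robber
is near the gadget, then the gadget is at one of the homes. -/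
structure IsPose (σ : ℤ) (A : Set (ℤ × ℤ)) (P : ℤ × ℤ → ℤ × ℤ) (homes : Set (ℤ × ℤ))
    (base : ℤ × ℤ) : Prop where
  lip : ∀ X Y, Within 2 X Y → X ∉ A → Y ∉ A → Within 1 (P X) (P Y)
  fixed : ∀ c ∈ homes, ∀ X, Within (3 * σ) X c → P X = c
  home : ∀ X, Within (3 * σ) X (P X) → P X ∈ homes
  far : ∀ X, ¬ Within (356 * σ) X 0 → P X = base
  base_mem : base ∈ homes
  bound : ∀ c ∈ homes, Within (354 * σ) c 0

theorem IsPose.reflect {σ : ℤ} {A : Set (ℤ × ℤ)} {P : ℤ × ℤ → ℤ × ℤ} {homes : Set (ℤ × ℤ)}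
    {base : ℤ × ℤ} (h : IsPose σ (flip ⁻¹' A) P homes base) :
    IsPose σ A (fun X => flip (P (flip X))) (flip ⁻¹' homes) (flip base) where
  lip X Y hXY hX hY := within_flip.2 <| h.lip _ _ (within_flip.2 hXY) (by simpa) (by simpa)
  fixed c hc X hX := by
    rw [h.fixed _ hc _ (within_flip.2 hX), flip_flip]
  home X hX := by
    simpa using h.home _ (within_flip_left.2 hX)
  far X hX := by rw [h.far _ (fun h' => hX (within_flip_zero.1 h'))]
  base_mem := by simpa using h.base_mem
  bound c hc := within_flip_zero.1 (h.bound _ hc)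

theorem isPose_const {σ : ℤ} {A : Set (ℤ × ℤ)} {c : ℤ × ℤ} (hc : Within (354 * σ) c 0) :
    IsPose σ A (fun _ => c) {c} c where
  lip _ _ _ _ _ := by simp [Within]
  fixed _ h _ _ := (Set.mem_singleton_iff.1 h).symm
  home _ _ := rfl
  far _ _ := rfl
  base_mem := rfl
  bound _ h := by rwa [Set.mem_singleton_iff.1 h]

theorem isPose_shift {σ N z H : ℤ} {A : Set (ℤ × ℤ)} (hσ : 4 ≤ σ) (hz : 4 * σ ≤ z)
    (hzN : z + 4 * σ ≤ N) (hN : N ≤ 93 * σ) (hH : N + 7 * σ ≤ H)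
    (hcut : ∀ X Y, Within 2 X Y → X ∉ A → Y ∉ A →
      (X.1 + X.2 < 0 ↔ Y.1 + Y.2 < 0) ∨ (H ≤ |X.1 - X.2| ∧ H ≤ |Y.1 - Y.2|)) :
    IsPose σ A (fun X => (shift σ N z H X - z, shift σ N z H X - z))
      {(-z, -z), (N - z, N - z)} (-z, -z) where
  lip X Y h hX hY := by
    have := shift_lip (σ := σ) (N := N) (z := z) h (hcut X Y h hX hY)
    rw [within_iff]
    simp only
    omega
  fixed c hc X hX := by
    rcases hc with rfl | hc
    · simp [shift_eq_zero_of_near hσ hz hX]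
    · rw [Set.mem_singleton_iff.1 hc] at hX ⊢
      simp [shift_eq_of_near hσ hz hzN hN hH hX]
  home X hX := by
    rcases shift_of_near_pose hσ hz hzN hN hH hX with h | h <;> simp [h]
  far X hX := by simp [shift_eq_zero_of_far hX]
  base_mem := by simp
  bound c hc := by
    rcases hc with rfl | hc
    · rw [within_iff]
      simp only [Prod.fst_zero, Prod.snd_zero]
      omega
    · rw [Set.mem_singleton_iff.1 hc, within_iff]
      simp only [Prod.fst_zero, Prod.snd_zero]
      omega

/-- When the robber is near a gadget, the gadget stands still at a home and its own guard property
applies. Otherwise it travels rigidly in its rest formation. The margin between `2 * σ` and `3 * σ`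
absorbs one move, so the two regimes agree at the transition. -/
theorem IsGuard.assemble {S ι : Type*} {σ : ℤ} (hσ : 4 ≤ σ) {W : S → Set (ℤ × ℤ)}
    {cop : S → ι → ℤ × ℤ → ℤ × ℤ} {rest : S → ι → ℤ × ℤ}
    (G : ∀ s, IsGuard σ (W s) (cop s) (rest s)) {A : Set (ℤ × ℤ)} {P : S → ℤ × ℤ → ℤ × ℤ}
    {homes : S → Set (ℤ × ℤ)} {base : S → ℤ × ℤ}
    (hA : A = {X | ∃ s, ∃ c ∈ homes s, X - c ∈ W s})
    (hP : ∀ s, IsPose σ A (P s) (homes s) (base s)) :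
    IsGuard (178 * σ) A (fun (p : S × ι) X => P p.1 X + cop p.1 p.2 (X - P p.1 X))
      (fun p => base p.1 + rest p.1 p.2) where
  lip X Y h hX hY := by
    have hA' : ∀ {X s c}, X ∉ A → c ∈ homes s → X - c ∉ W s := fun hX hc h' =>
      hX (hA ▸ ⟨_, _, hc, h'⟩)
    -- the case where the robber is near the gadget
    have key : ∀ X Y, Within 2 X Y → X ∉ A → Y ∉ A → ∀ s i, Within (2 * σ) X (P s X) →
        Within 1 (P s X + cop s i (X - P s X)) (P s Y + cop s i (Y - P s Y)) := by
      intro X Y h hX hY s i hn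
      have hc := (hP s).home X (hn.mono (by omega))
      have hY' : P s Y = P s X := (hP s).fixed _ hc Y ((h.symm.trans hn).mono (by omega))
      rw [hY', within_add_left]
      exact (G s).lip _ _ (within_sub_right.2 h) (hA' hX hc) (hA' hY hc) i
    rintro ⟨s, i⟩
    by_cases h1 : Within (2 * σ) X (P s X)
    · exact key X Y h hX hY s i h1
    by_cases h2 : Within (2 * σ) Y (P s Y)
    · exact (key Y X h.symm hY hX s i h2).symm
    simp only
    rw [(G s).far _ (fun h' => h1 (within_sub_zero.1 h')),
      (G s).far _ (fun h' => h2 (within_sub_zero.1 h')), within_add_right]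
    exact (hP s).lip X Y h hX hY
  catches X Y h hX hY := by
    rw [hA] at hY
    obtain ⟨s, c, hc, hW⟩ := hY
    have h1 := within_sub_zero.1 ((G s).near _ hW)
    have hPX : P s X = c := (hP s).fixed c hc X ((h.trans h1).mono (by omega))
    obtain ⟨i, hi⟩ := (G s).catches (X - c) (Y - c) (within_sub_right.2 h)
      (fun h' => hX (hA ▸ ⟨s, c, hc, h'⟩)) hW
    refine ⟨(s, i), ?_⟩
    simp only
    rw [hPX, within_add_left_iff_sub]
    exact hi
  far X hX p := by
    have hX' : ¬ Within (356 * σ) X 0 := fun h => hX (h.mono (by omega))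
    rw [(hP p.1).far X hX', (G p.1).far]
    intro h
    exact hX' (((within_sub_zero.1 h).trans ((hP p.1).bound _ (hP p.1).base_mem)).mono (by omega))
  near X hX := by
    rw [hA] at hX
    obtain ⟨s, c, hc, hW⟩ := hX
    exact ((within_sub_zero.1 ((G s).near _ hW)).trans ((hP s).bound c hc)).mono (by omega)

/-- The homes of the `t`-th of the `T + 4` gadgets that guard a diagonal. -/
def slotHomes (σ T t : ℤ) : Set (ℤ × ℤ) :=
  if t < 7 then {((t - 3) * σ, (t - 3) * σ)}
  else {(-((t - 3) * σ), -((t - 3) * σ)), ((T + 4) * σ - (t - 3) * σ, (T + 4) * σ - (t - 3) * σ)}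

/-- The position of the `t`-th of the gadgets that guard a diagonal. -/
def slotPose (σ T H t : ℤ) (X : ℤ × ℤ) : ℤ × ℤ :=
  if t < 7 then ((t - 3) * σ, (t - 3) * σ)
  else (shift σ ((T + 4) * σ) ((t - 3) * σ) H X - (t - 3) * σ,
    shift σ ((T + 4) * σ) ((t - 3) * σ) H X - (t - 3) * σ)

theorem exists_isPose_slot {σ T H t : ℤ} {A : Set (ℤ × ℤ)} (hσ : 4 ≤ σ) (hT : T ≤ 89)
    (hH : (T + 11) * σ ≤ H) (ht0 : 0 ≤ t) (ht : t < T + 4)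
    (hcut : ∀ X Y, Within 2 X Y → X ∉ A → Y ∉ A →
      (X.1 + X.2 < 0 ↔ Y.1 + Y.2 < 0) ∨ (H ≤ |X.1 - X.2| ∧ H ≤ |Y.1 - Y.2|)) :
    ∃ base, IsPose σ A (slotPose σ T H t) (slotHomes σ T t) base := by
  unfold slotPose slotHomes
  split_ifs with h
  · refine ⟨_, isPose_const ?_⟩
    rw [within_iff]
    simp only [Prod.fst_zero, Prod.snd_zero]
    constructor <;> constructor <;> nlinarith
  · exact ⟨_, isPose_shift hσ (by nlinarith) (by nlinarith) (by nlinarith) (by nlinarith) hcut⟩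

/-- The seven places `|m| ≤ 3` have their own immobile gadgets; for `4 ≤ z ≤ T` one gadget serves
both `-z` and `T + 4 - z`. Thus `T + 4` gadgets cover `2 * T + 1` places. -/
theorem exists_slot {T m : ℤ} (σ : ℤ) (hm : -T ≤ m) (hm' : m ≤ T) :
    ∃ t, 0 ≤ t ∧ t < T + 4 ∧ (m * σ, m * σ) ∈ slotHomes σ T t := by
  by_cases h : -3 ≤ m ∧ m ≤ 3
  · refine ⟨m + 3, by omega, by omega, ?_⟩
    simp [slotHomes, show m + 3 < 7 by omega]
  by_cases h' : m < 0
  · refine ⟨-m + 3, by omega, by omega, ?_⟩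
    simp [slotHomes, show ¬ -m + 3 < 7 by omega]
  · refine ⟨T + 4 - m + 3, by omega, by omega, ?_⟩
    simp only [slotHomes, show ¬ T + 4 - m + 3 < 7 by omega, if_false]
    right
    simp only [Set.mem_singleton_iff, Prod.mk.injEq]
    constructor <;> ring

/-- A row of translates of `W` along the diagonal separates. -/
theorem Separates.row {σ T : ℤ} {W A : Set (ℤ × ℤ)} (hσ : 4 ≤ σ) (hT : 0 ≤ T)
    (hW : Separates σ W) (hA : ∀ m, -T ≤ m → m ≤ T → ∀ X, X - (m * σ, m * σ) ∈ W → X ∈ A)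
    {X Y : ℤ × ℤ} (h : Within 2 X Y) (hX : X ∉ A) (hY : Y ∉ A)
    (hXu : |X.1 + X.2| ≤ (2 * T + 1) * σ) :
    (0 < X.1 - X.2 ∧ 0 < Y.1 - Y.2) ∨ (X.1 - X.2 < 0 ∧ Y.1 - Y.2 < 0) := by
  -- The translate whose centre is nearest in `u`. After the move `u` is still within `σ + 4` of
  -- that centre, the slack built into `Separates`.
  obtain ⟨m, h1, h2, h3, h4⟩ : ∃ m, -T ≤ m ∧ m ≤ T ∧ -σ ≤ X.1 + X.2 - 2 * (m * σ) ∧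
      X.1 + X.2 - 2 * (m * σ) ≤ σ := by
    rw [abs_le] at hXu
    set u := X.1 + X.2
    have e := Int.mul_ediv_add_emod (u + σ) (2 * σ)
    have e1 := Int.emod_nonneg (u + σ) (b := 2 * σ) (by omega)
    have e2 := Int.emod_lt_of_pos (u + σ) (b := 2 * σ) (by omega)
    set m := (u + σ) / (2 * σ)
    by_cases hm : m ≤ T
    · refine ⟨m, ?_, hm, by linarith, by linarith⟩
      by_contra hcon
      nlinarith
    · refine ⟨T, by omega, le_rfl, ?_, ?_⟩ <;> nlinarith
  have := hW (X - (m * σ, m * σ)) (Y - (m * σ, m * σ)) (within_sub_right.2 h)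
    (fun h' => hX (hA m h1 h2 X h')) (fun h' => hY (hA m h1 h2 Y h'))
  simp only [Prod.fst_sub, Prod.snd_sub, abs_le] at this
  rw [within_iff] at h
  have := this (by omega) (by omega)
  omega

theorem Separates.row_or_far {σ T H : ℤ} {W A : Set (ℤ × ℤ)} (hσ : 4 ≤ σ) (hT : 0 ≤ T)
    (hW : Separates σ W) (hA : ∀ m, -T ≤ m → m ≤ T → ∀ X, X - (m * σ, m * σ) ∈ W → X ∈ A)
    (hH : H + 4 ≤ (2 * T + 1) * σ)
    {X Y : ℤ × ℤ} (h : Within 2 X Y) (hX : X ∉ A) (hY : Y ∉ A) :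
    (X.1 - X.2 < 0 ↔ Y.1 - Y.2 < 0) ∨ (H ≤ |X.1 + X.2| ∧ H ≤ |Y.1 + Y.2|) := by
  by_cases hu : |X.1 + X.2| ≤ (2 * T + 1) * σ
  · have := hW.row hσ hT hA h hX hY hu
    omega
  · right
    rw [within_iff] at h
    simp only [abs_le, le_abs] at *
    generalize (2 * T + 1) * σ = K at *
    omega

/-- The recursive step: guards for a cross-shaped fence, made out of guards on a smaller scale. -/
theorem IsGuard.exists_step {ι : Type} {σ : ℤ} (hσ : 4 ≤ σ) {W : Set (ℤ × ℤ)}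
    {cop : ι → ℤ × ℤ → ℤ × ℤ} {rest : ι → ℤ × ℤ} (G : IsGuard σ W cop rest)
    (hW : Separates σ W) :
    ∃ (W' : Set (ℤ × ℤ)) (cop' : (Fin 93 ⊕ Fin 54) × ι → ℤ × ℤ → ℤ × ℤ)
      (rest' : (Fin 93 ⊕ Fin 54) × ι → ℤ × ℤ),
      IsGuard (178 * σ) W' cop' rest' ∧ Separates (178 * σ) W' := by
  -- `T = 89` gives a row reaching `|u| = 179σ`, enough for scale `178σ`. Its gadgets need a needle
  -- of height `(89 + 11)σ = 100σ`, which `T = 50` supplies. The counts are `89 + 4` and `50 + 4`.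
  let Ws : Fin 93 ⊕ Fin 54 → Set (ℤ × ℤ) := Sum.elim (fun _ => W) (fun _ => flip ⁻¹' W)
  let homes : Fin 93 ⊕ Fin 54 → Set (ℤ × ℤ) :=
    Sum.elim (fun t => slotHomes σ 89 (t : ℕ)) (fun t => flip ⁻¹' slotHomes σ 50 (t : ℕ))
  let A : Set (ℤ × ℤ) := {X | ∃ s, ∃ c ∈ homes s, X - c ∈ Ws s}
  have hrow : ∀ m : ℤ, -89 ≤ m → m ≤ 89 → ∀ X, X - (m * σ, m * σ) ∈ W → X ∈ A := by
    intro m h1 h2 X hX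
    obtain ⟨t, ht0, ht, hmem⟩ := exists_slot (T := 89) σ h1 h2
    refine ⟨Sum.inl ⟨t.toNat, by omega⟩, _, ?_, hX⟩
    simpa [homes, ht0] using hmem
  have hcol : ∀ m : ℤ, -50 ≤ m → m ≤ 50 → ∀ X, X - (m * σ, m * σ) ∈ W → X ∈ flip ⁻¹' A := by
    intro m h1 h2 X hX
    obtain ⟨t, ht0, ht, hmem⟩ := exists_slot (T := 50) σ h1 h2
    refine ⟨Sum.inr ⟨t.toNat, by omega⟩, flip (m * σ, m * σ), ?_, ?_⟩
    · simpa [homes, ht0] using hmem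
    · simpa [Ws, flip_sub] using hX
  have hcutrow : ∀ X Y, Within 2 X Y → X ∉ A → Y ∉ A → _ := fun X Y =>
    Separates.row_or_far hσ (by norm_num) hW hrow (H := 178 * σ) (by omega)
  have hcutcol : ∀ X Y, Within 2 X Y → X ∉ A → Y ∉ A →
      (X.1 + X.2 < 0 ↔ Y.1 + Y.2 < 0) ∨ (100 * σ ≤ |X.1 - X.2| ∧ 100 * σ ≤ |Y.1 - Y.2|) := by
    intro X Y h hX hY
    simpa [← sub_eq_add_neg] using
      Separates.row_or_far hσ (by norm_num) hW hcol (H := 100 * σ) (by omega)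
        (within_flip.2 h) (by simpa) (by simpa)
  have hpl : ∀ t : Fin 93, ∃ base, IsPose σ A (slotPose σ 89 (100 * σ) (t : ℕ))
      (slotHomes σ 89 (t : ℕ)) base := fun t =>
    exists_isPose_slot hσ (by norm_num) (by omega) (by omega) (by omega) hcutcol
  have hpr : ∀ t : Fin 54, ∃ base, IsPose σ (flip ⁻¹' A) (slotPose σ 50 (178 * σ) (t : ℕ))
      (slotHomes σ 50 (t : ℕ)) base := fun t =>
    exists_isPose_slot hσ (by norm_num) (by omega) (by omega) (by omega) (by
      intro X Y h hX hY
      simpa [← sub_eq_add_neg] using hcutrow (flip X) (flip Y) (within_flip.2 h) hX hY)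
  choose bl hbl using hpl
  choose br hbr using hpr
  have hfin := IsGuard.assemble (S := Fin 93 ⊕ Fin 54) (ι := ι) hσ (W := Ws)
    (cop := Sum.elim (fun _ => cop) (fun _ i X => flip (cop i (flip X))))
    (rest := Sum.elim (fun _ => rest) (fun _ i => flip (rest i)))
    (by rintro (s | s); exacts [G, G.reflect]) (A := A) (homes := homes)
    (P := Sum.elim (fun t => slotPose σ 89 (100 * σ) (t : ℕ))
      (fun t X => flip (slotPose σ 50 (178 * σ) (t : ℕ) (flip X))))
    (base := Sum.elim bl (fun t => flip (br t))) rfl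
    (by rintro (s | s); exacts [hbl s, (hbr s).reflect])
  refine ⟨A, _, _, hfin, ?_⟩
  intro X Y h hX hY hu _
  exact hW.row hσ (by norm_num) hrow h hX hY (hu.trans (by omega))

theorem exists_guard (k : ℕ) : ∃ (ι : Type) (_ : Fintype ι) (W : Set (ℤ × ℤ))
    (cop : ι → ℤ × ℤ → ℤ × ℤ) (rest : ι → ℤ × ℤ),
    IsGuard (8 * 178 ^ k) W cop rest ∧ Separates (8 * 178 ^ k) W ∧
      Fintype.card ι = 13 * 147 ^ k := by
  induction k with
  | zero =>
    obtain ⟨W, cop, rest, h, h'⟩ := exists_guard_base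
    exact ⟨Fin 13, inferInstance, W, cop, rest, by simpa using h, by simpa using h', by simp⟩
  | succ k ih =>
    obtain ⟨ι, _, W, cop, rest, h, h', hc⟩ := ih
    have hk : (1 : ℤ) ≤ 178 ^ k := one_le_pow₀ (by norm_num)
    obtain ⟨W', cop', rest', g, g'⟩ := h.exists_step (by omega) h'
    have e : (8 * 178 ^ (k + 1) : ℤ) = 178 * (8 * 178 ^ k) := by ring
    refine ⟨_, inferInstance, W', cop', rest', by rwa [e], by rwa [e], ?_⟩
    simp [hc]
    ring

/-! ### Bringing a guard into position during play -/

theorem history_length {V : Type*} (r : ℕ → V) (t : ℕ) : (history r t).length = t := by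
  induction t with
  | zero => rfl
  | succ t ih => simp [history, ih]

theorem history_reverse {V : Type*} (r : ℕ → V) (t : ℕ) :
    (history r t).reverse = (List.range t).map r := by
  induction t with
  | zero => rfl
  | succ t ih => simp [history, ih, List.range_succ]

theorem history_map {V V' : Type*} (f : V → V') (r : ℕ → V) (t : ℕ) :
    (history r t).map f = history (fun t => f (r t)) t := by
  induction t with
  | zero => rfl
  | succ t ih => simp [history, ih]

theorem history_reverse_getD {V : Type*} (r : ℕ → V) {s t : ℕ} (h : s < t) (x : V) :
    (history r t).reverse.getD s x = r s := by
  simp [history_reverse, h]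

/-- One king's move from `p` towards `q`. -/
def approach (p q : ℤ × ℤ) : ℤ × ℤ :=
  (p.1 + max (-1) (min 1 (q.1 - p.1)), p.2 + max (-1) (min 1 (q.2 - p.2)))

theorem within_approach (p q : ℤ × ℤ) : Within 1 p (approach p q) := by
  simp only [within_iff, approach]
  omega

theorem Within.approach {p q : ℤ × ℤ} {r : ℤ} (h : Within (r + 1) p q) (hr : 0 ≤ r) :
    Within r (approach p q) q := by
  simp only [within_iff, FastRobber.approach] at *
  omega

theorem within_zero_iff {p q : ℤ × ℤ} : Within 0 p q ↔ p = q := by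
  rw [within_iff, Prod.ext_iff]
  omega

/-- A cop in `ℤ²` who always moves towards his current target. -/
def chase (target : List (ℤ × ℤ) → ℤ × ℤ) : List (ℤ × ℤ) → ℤ × ℤ
  | [] => 0
  | v :: h => approach (chase target h) (target (v :: h))

theorem within_chase (target : List (ℤ × ℤ) → ℤ × ℤ) (v : ℤ × ℤ) (h : List (ℤ × ℤ)) :
    Within 1 (chase target h) (chase target (v :: h)) :=
  within_approach _ _

theorem chase_eq {target : List (ℤ × ℤ) → ℤ × ℤ} {r : ℕ → ℤ × ℤ} {t : ℕ}
    (h : Within 1 (chase target (history r t)) (target (history r (t + 1)))) :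
    chase target (history r (t + 1)) = target (history r (t + 1)) :=
  within_zero_iff.1 (Within.approach h le_rfl)

theorem chase_eq_zero {target : List (ℤ × ℤ) → ℤ × ℤ} {r : ℕ → ℤ × ℤ} {t : ℕ}
    (h : ∀ s < t, target (history r (s + 1)) = 0) : chase target (history r t) = 0 := by
  induction t with
  | zero => rfl
  | succ t ih =>
    rw [chase_eq, h t t.lt_succ_self]
    rw [h t t.lt_succ_self, ih fun s hs => h s (hs.trans t.lt_succ_self)]
    simp [Within]

/-- The distance to a constant target drops by one per move until it is zero. -/
theorem chase_eq_of_const {target : List (ℤ × ℤ) → ℤ × ℤ} {r : ℕ → ℤ × ℤ} {t T : ℕ} {q : ℤ × ℤ}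
    (h0 : Within T (chase target (history r t)) q)
    (h : ∀ s, t ≤ s → s < t + T → target (history r (s + 1)) = q) :
    chase target (history r (t + T)) = q := by
  have key : ∀ s ≤ T, Within ((T : ℤ) - s) (chase target (history r (t + s))) q := by
    intro s hs
    induction s with
    | zero => simpa using h0
    | succ s ih =>
      have := (ih (by omega)).mono (s := (T : ℤ) - (s + 1 : ℕ) + 1) (by push_cast; omega)
      have := this.approach (by omega)
      rwa [← h (t + s) (by omega) (by omega)] at this ⊢
  simpa [within_zero_iff] using key T le_rfl

/-- A play of a robber of speed `2` on `ℤ²` who stays within distance `n` of the origin. -/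
structure IsPlay (n : ℤ) (r : ℕ → ℤ × ℤ) : Prop where
  step : ∀ t, Within 2 (r t) (r (t + 1))
  box : ∀ t, Within n (r t) 0

open Classical in
/-- The target of a cop of a guard: he waits at the origin until time `t₀`, then he has time `T` to
walk to his place in the guard, which is put at offset `d` of where the robber was at time `t₀`, and
then he plays as a member of the guard. -/
noncomputable def guardTarget (t₀ T : ℕ) (d : ℤ × ℤ) (W : Set (ℤ × ℤ)) (cop : ℤ × ℤ → ℤ × ℤ)
    (rest : ℤ × ℤ) (h : List (ℤ × ℤ)) : ℤ × ℤ :=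
  if h.length ≤ t₀ then 0
  else if h.length ≤ t₀ + T then h.reverse.getD t₀ 0 + d + rest
  else if h.headD 0 - (h.reverse.getD t₀ 0 + d) ∈ W then h.headD 0
  else h.reverse.getD t₀ 0 + d + cop (h.headD 0 - (h.reverse.getD t₀ 0 + d))

section guardTarget

variable {t₀ T t : ℕ} {d rest : ℤ × ℤ} {W : Set (ℤ × ℤ)} {cop : ℤ × ℤ → ℤ × ℤ} {r : ℕ → ℤ × ℤ}

theorem guardTarget_of_lt (h : t < t₀) :
    guardTarget t₀ T d W cop rest (history r (t + 1)) = 0 := by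
  rw [guardTarget, history_length, if_pos (by omega)]

theorem guardTarget_of_mem_Ico (h : t₀ ≤ t) (h' : t < t₀ + T) :
    guardTarget t₀ T d W cop rest (history r (t + 1)) = r t₀ + d + rest := by
  rw [guardTarget, history_length, if_neg (by omega), if_pos (by omega),
    history_reverse_getD _ (by omega)]

theorem guardTarget_of_mem (h : t₀ + T ≤ t) (hW : r t - (r t₀ + d) ∈ W) :
    guardTarget t₀ T d W cop rest (history r (t + 1)) = r t := by
  rw [guardTarget, history_length, if_neg (by omega), if_neg (by omega),
    history_reverse_getD _ (by omega)]
  exact if_pos hW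

theorem guardTarget_of_not_mem (h : t₀ + T ≤ t) (hW : r t - (r t₀ + d) ∉ W) :
    guardTarget t₀ T d W cop rest (history r (t + 1)) = r t₀ + d + cop (r t - (r t₀ + d)) := by
  rw [guardTarget, history_length, if_neg (by omega), if_neg (by omega),
    history_reverse_getD _ (by omega)]
  exact if_neg hW

end guardTarget

/-- A robber far from the guard when the walk ends finds every member at its rest position, which is
exactly where the memoryless rule wants it. From then on `lip` makes the rule playable and `catches`
punishes a step into `W`. -/
theorem IsGuard.not_mem_of_escapes {ι : Type*} {σ : ℤ} {W : Set (ℤ × ℤ)}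
    {cop : ι → ℤ × ℤ → ℤ × ℤ} {rest : ι → ℤ × ℤ} (G : IsGuard σ W cop rest) {n : ℤ}
    {r : ℕ → ℤ × ℤ} (hr : IsPlay n r) {t₀ T : ℕ} {d : ℤ × ℤ}
    (hT : ∀ i, Within T 0 (r t₀ + d + rest i))
    (hesc : ∀ i t, chase (guardTarget t₀ T d W (cop i) (rest i)) (history r (t + 1)) ≠ r t)
    (hfar : ¬ Within (2 * σ) (r (t₀ + T)) (r t₀ + d)) {t : ℕ} (ht : t₀ + T ≤ t) :
    r t - (r t₀ + d) ∉ W := by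
  -- The induction must also carry that every member is in formation.
  suffices h : r t - (r t₀ + d) ∉ W ∧ ∀ i,
      chase (guardTarget t₀ T d W (cop i) (rest i)) (history r (t + 1)) =
        r t₀ + d + cop i (r t - (r t₀ + d)) from h.1
  have hfar' := hfar
  rw [← within_sub_zero] at hfar'
  induction t, ht using Nat.le_induction with
  | base =>
    have hW : r (t₀ + T) - (r t₀ + d) ∉ W := fun h => hfar' (G.near _ h)
    refine ⟨hW, fun i => ?_⟩
    have h0 : chase (guardTarget t₀ T d W (cop i) (rest i)) (history r t₀) = 0 :=
      chase_eq_zero fun s hs => guardTarget_of_lt hs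
    have h1 : chase (guardTarget t₀ T d W (cop i) (rest i)) (history r (t₀ + T)) =
        r t₀ + d + rest i :=
      chase_eq_of_const (h0.symm ▸ hT i) fun s hs hs' => guardTarget_of_mem_Ico hs hs'
    rw [chase_eq, guardTarget_of_not_mem le_rfl hW]
    rw [guardTarget_of_not_mem le_rfl hW, h1, G.far _ hfar']
    simp [Within]
  | succ t ht ih =>
    obtain ⟨hW, hpos⟩ := ih
    have hstep := (within_sub_right (c := r t₀ + d)).2 (hr.step t)
    have hW' : r (t + 1) - (r t₀ + d) ∉ W := by
      intro hmem
      obtain ⟨i, hi⟩ := G.catches _ _ hstep hW hmem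
      apply hesc i (t + 1)
      rw [chase_eq, guardTarget_of_mem (by omega) hmem]
      rwa [guardTarget_of_mem (by omega) hmem, hpos, within_add_left_iff_sub]
    refine ⟨hW', fun i => ?_⟩
    rw [chase_eq, guardTarget_of_not_mem (by omega) hW']
    rw [guardTarget_of_not_mem (by omega) hW', hpos, within_add_left]
    exact G.lip _ _ hstep hW hW' i

/-! ### Confining the robber to smaller and smaller squares -/

/-- `m` cops on `ℤ²` can force a robber who stays within distance `n` of the origin to be confined,
from some time on, to a diagonal square of radius `ρ`. -/
def Confines (n ρ : ℤ) (m : ℕ) : Prop :=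
  ∃ (Ω : Type) (_ : Fintype Ω) (f : Ω → List (ℤ × ℤ) → ℤ × ℤ) (t₀ : ℕ), Fintype.card Ω ≤ m ∧
    (∀ i v h, Within 1 (f i h) (f i (v :: h))) ∧
    ∀ r, IsPlay n r → (∀ i t, f i (history r (t + 1)) ≠ r t) → ∀ t, t₀ ≤ t →
      |((r t).1 + (r t).2) - ((r t₀).1 + (r t₀).2)| ≤ ρ ∧
      |((r t).1 - (r t).2) - ((r t₀).1 - (r t₀).2)| ≤ ρ

/-- The robber cannot cross a complete line of guards. -/
theorem Separates.line {σ Λ : ℤ} {W : Set (ℤ × ℤ)} (hσ : 4 ≤ σ) (hΛ : 0 ≤ Λ) (hW : Separates σ W)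
    {n : ℤ} {r : ℕ → ℤ × ℤ} (hr : IsPlay n r) {e : ℤ × ℤ} {t₁ : ℕ}
    (hu : ∀ t, t₁ ≤ t → |((r t).1 + (r t).2) - (e.1 + e.2)| ≤ (2 * Λ + 1) * σ)
    (hguard : ∀ m, -Λ ≤ m → m ≤ Λ → ∀ t, t₁ ≤ t → r t - (e + (m * σ, m * σ)) ∉ W) {t : ℕ}
    (ht : t₁ ≤ t) :
    ((r t₁).1 - (r t₁).2 < e.1 - e.2 → (r t).1 - (r t).2 < e.1 - e.2) ∧
    (e.1 - e.2 < (r t₁).1 - (r t₁).2 → e.1 - e.2 < (r t).1 - (r t).2) := by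
  induction t, ht using Nat.le_induction with
  | base => simp
  | succ t ht ih =>
    have hnot : ∀ s, t₁ ≤ s → r s - e ∉
        {X | ∃ m, -Λ ≤ m ∧ m ≤ Λ ∧ X - (m * σ, m * σ) ∈ W} := by
      rintro s hs ⟨m, h1, h2, h⟩
      exact hguard m h1 h2 s hs (by rwa [← sub_sub])
    have := hW.row hσ hΛ (A := {X | ∃ m, -Λ ≤ m ∧ m ≤ Λ ∧ X - (m * σ, m * σ) ∈ W})
      (fun m h1 h2 X hX => ⟨m, h1, h2, hX⟩) (within_sub_right.2 (hr.step t)) (hnot t ht)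
      (hnot (t + 1) (by omega)) (by
        have := hu t ht
        rw [abs_le] at *
        simp only [Prod.fst_sub, Prod.snd_sub]
        omega)
    simp only [Prod.fst_sub, Prod.snd_sub] at this
    omega

theorem Separates.confine {σ : ℤ} {W : Set (ℤ × ℤ)} (hσ : 4 ≤ σ) (hW : Separates σ W)
    {n : ℤ} {r : ℕ → ℤ × ℤ} (hr : IsPlay n r) {a : ℤ × ℤ} {t₁ : ℕ}
    (hu : ∀ t, t₁ ≤ t → |((r t).1 + (r t).2) - (a.1 + a.2)| ≤ 1068 * σ)
    (hv : |((r t₁).1 - (r t₁).2) - (a.1 - a.2)| ≤ 1068 * σ)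
    (hguard : ∀ i j : ℤ, -540 ≤ i → i ≤ 540 → -540 ≤ j → j ≤ 540 →
      ¬ Within (2 * σ) (r t₁) (a + (i * σ + j * σ, i * σ - j * σ)) →
      ∀ t, t₁ ≤ t → r t - (a + (i * σ + j * σ, i * σ - j * σ)) ∉ W) {t : ℕ} (ht : t₁ ≤ t) :
    |((r t).1 - (r t).2) - ((r t₁).1 - (r t₁).2)| ≤ 6 * σ := by
  -- the line number `j` is not crossed
  have key : ∀ j : ℤ, -540 ≤ j → j ≤ 540 →
      4 * σ < |((r t₁).1 - (r t₁).2) - (a.1 - a.2 + 2 * (j * σ))| →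
      ((r t₁).1 - (r t₁).2 < a.1 - a.2 + 2 * (j * σ) →
        (r t).1 - (r t).2 < a.1 - a.2 + 2 * (j * σ)) ∧
      (a.1 - a.2 + 2 * (j * σ) < (r t₁).1 - (r t₁).2 →
        a.1 - a.2 + 2 * (j * σ) < (r t).1 - (r t).2) := by
    intro j h1 h2 hfar
    have hj := hW.line hσ (Λ := 540) (by norm_num) hr (e := a + (j * σ, -(j * σ))) (t₁ := t₁) (by
      intro t ht
      have := hu t ht
      simp only [Prod.fst_add, Prod.snd_add, abs_le] at *
      omega) (by
      intro i h3 h4 t ht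
      have e : a + (j * σ, -(j * σ)) + (i * σ, i * σ) = a + (i * σ + j * σ, i * σ - j * σ) := by
        ext <;> simp <;> ring
      rw [e]
      refine hguard i j h3 h4 h1 h2 ?_ t ht
      -- Being within `2 * σ` of a gadget of the line would put the robber within `4 * σ` of the
      -- line in `v`.
      intro hw
      rw [within_iff] at hw
      simp only [Prod.fst_add, Prod.snd_add, lt_abs] at *
      omega) ht
    simp only [Prod.fst_add, Prod.snd_add] at hj
    omega
  set x := (r t₁).1 - (r t₁).2 - (a.1 - a.2) with hx
  have hσ' : 0 < 2 * σ := by omega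
  rw [abs_le] at hv ⊢
  constructor
  · have e := Int.mul_ediv_add_emod (-x) (2 * σ)
    have e1 := Int.emod_nonneg (-x) hσ'.ne'
    have e2 := Int.emod_lt_of_pos (-x) hσ'
    set q := (-x) / (2 * σ)
    have q1 : q ≤ 534 := by
      by_contra hcon
      nlinarith
    have q2 : -535 ≤ q := by
      by_contra hcon
      nlinarith
    have e3 : (-(q + 3)) * σ = - (q * σ) - 3 * σ := by ring
    have e4 : 2 * σ * q = 2 * (q * σ) := by ring
    -- The third mesh line beyond the robber is more than `4σ` and at most `6σ` away; the bounds on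
    -- `q` keep its index within 540.
    have := key (-(q + 3)) (by omega) (by omega) (by rw [e3, lt_abs]; omega)
    rw [e3] at this
    omega
  · have e := Int.mul_ediv_add_emod x (2 * σ)
    have e1 := Int.emod_nonneg x hσ'.ne'
    have e2 := Int.emod_lt_of_pos x hσ'
    set q := x / (2 * σ)
    have q1 : q ≤ 534 := by
      by_contra hcon
      nlinarith
    have q2 : -535 ≤ q := by
      by_contra hcon
      nlinarith
    have e3 : (q + 3) * σ = q * σ + 3 * σ := by ring
    have e4 : 2 * σ * q = 2 * (q * σ) := by ring
    have := key (q + 3) (by omega) (by omega) (by rw [e3, lt_abs]; omega)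
    rw [e3] at this
    omega

theorem exists_within_zero {ι : Type*} [Fintype ι] (f : ι → ℤ × ℤ) :
    ∃ R : ℤ, 0 ≤ R ∧ ∀ i, Within R (f i) 0 := by
  refine ⟨∑ i, (|(f i).1| + |(f i).2|), Finset.sum_nonneg fun i _ => by positivity, fun i => ?_⟩
  have := Finset.single_le_sum (f := fun i => |(f i).1| + |(f i).2|) (fun i _ => by positivity)
    (Finset.mem_univ i)
  have h1 := abs_nonneg (f i).1
  have h2 := abs_nonneg (f i).2
  simp only [Within, Prod.fst_zero, Prod.snd_zero, sub_zero]
  omega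

theorem confines_trivial {n ρ : ℤ} (h : 4 * n ≤ ρ) : Confines n ρ 0 := by
  refine ⟨Empty, inferInstance, fun i => i.elim, 0, by simp, fun i => i.elim, ?_⟩
  intro r hr _ t _
  have h1 := hr.box t
  have h2 := hr.box 0
  simp only [within_iff, Prod.fst_zero, Prod.snd_zero, sub_zero, abs_le] at *
  omega

theorem IsPlay.reflect {n : ℤ} {r : ℕ → ℤ × ℤ} (h : IsPlay n r) :
    IsPlay n (fun t => flip (r t)) :=
  ⟨fun t => within_flip.2 (h.step t), fun t => within_flip_zero.2 (h.box t)⟩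

theorem flip_add (X Y : ℤ × ℤ) : flip (X + Y) = flip X + flip Y := by
  ext
  · rfl
  · simp only [flip_snd, Prod.snd_add]
    omega

/-- Guards are placed on a mesh of both diagonal directions around `r t₀`. Those near the robber
when the walk ends may be useless, but all lines farther off are complete. The earlier cops keep
playing, since their confinement prevents him from going around the ends of the lines. -/
theorem Confines.refine {n ρ σ : ℤ} {m : ℕ} (hn : 0 ≤ n) (hσ : 4 ≤ σ) (hρ : ρ ≤ 1068 * σ)
    (h : Confines n ρ m) {ι : Type} [Fintype ι] {W : Set (ℤ × ℤ)} {cop : ι → ℤ × ℤ → ℤ × ℤ}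
    {rest : ι → ℤ × ℤ} (G : IsGuard σ W cop rest) (hW : Separates σ W) :
    Confines n (6 * σ) (m + 2 * 1081 ^ 2 * Fintype.card ι) := by
  obtain ⟨Ω, _, f, t₀, hcard, hlegal, hf⟩ := h
  obtain ⟨R, hR0, hR⟩ := exists_within_zero rest
  let d : Fin 1081 → Fin 1081 → ℤ × ℤ := fun i j =>
    (((i : ℤ) - 540) * σ + ((j : ℤ) - 540) * σ, ((i : ℤ) - 540) * σ - ((j : ℤ) - 540) * σ)
  -- An upper bound for the walk from the origin: position of the robber, mesh offset, rest
  -- position.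
  let T : ℕ := (n + 1080 * σ + R).toNat
  let g : Bool × Fin 1081 × Fin 1081 × ι → List (ℤ × ℤ) → ℤ × ℤ := fun p =>
    chase (if p.1 then guardTarget t₀ T (d p.2.1 p.2.2.1) W (cop p.2.2.2) (rest p.2.2.2)
      else guardTarget t₀ T (d p.2.1 p.2.2.1) (flip ⁻¹' W)
        (fun X => flip (cop p.2.2.2 (flip X))) (flip (rest p.2.2.2)))
  refine ⟨Ω ⊕ (Bool × Fin 1081 × Fin 1081 × ι), inferInstance, Sum.elim f g, t₀ + T, ?_, ?_, ?_⟩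
  · simp only [Fintype.card_sum, Fintype.card_prod, Fintype.card_bool, Fintype.card_fin]
    ring_nf
    omega
  · rintro (i | i) v h
    · exact hlegal i v h
    · exact within_chase _ _ _
  intro r hr hesc
  have hconf := hf r hr (fun i => hesc (Sum.inl i))
  have hd : ∀ i j, Within (1080 * σ) (d i j) 0 := by
    intro i j
    have hi := i.2
    have hj := j.2
    simp only [within_iff, d, Prod.fst_zero, Prod.snd_zero]
    refine ⟨⟨?_, ?_⟩, ?_, ?_⟩ <;> nlinarith
  have hT : ∀ i j x, Within R x 0 → Within T 0 (r t₀ + d i j + x) := by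
    intro i j x hx
    have h1 := hr.box t₀
    have h2 := hd i j
    simp only [within_iff, Prod.fst_add, Prod.snd_add, Prod.fst_zero, Prod.snd_zero, T] at *
    omega
  have hidx : ∀ i j : ℤ, -540 ≤ i → i ≤ 540 → -540 ≤ j → j ≤ 540 →
      ∃ i' j' : Fin 1081, d i' j' = (i * σ + j * σ, i * σ - j * σ) := by
    intro i j h1 h2 h3 h4
    refine ⟨⟨(i + 540).toNat, by omega⟩, ⟨(j + 540).toNat, by omega⟩, ?_⟩
    simp only [d]
    rw [Int.toNat_of_nonneg (by omega), Int.toNat_of_nonneg (by omega)]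
    simp
  have hg1 : ∀ i j : ℤ, -540 ≤ i → i ≤ 540 → -540 ≤ j → j ≤ 540 →
      ¬ Within (2 * σ) (r (t₀ + T)) (r t₀ + (i * σ + j * σ, i * σ - j * σ)) →
      ∀ t, t₀ + T ≤ t → r t - (r t₀ + (i * σ + j * σ, i * σ - j * σ)) ∉ W := by
    intro i j h1 h2 h3 h4 hfar t ht
    obtain ⟨i', j', e⟩ := hidx i j h1 h2 h3 h4
    rw [← e] at hfar ⊢
    exact G.not_mem_of_escapes hr (fun x => hT i' j' _ (hR x))
      (fun x t => hesc (Sum.inr (true, i', j', x)) t) hfar ht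
  have hg2 : ∀ i j : ℤ, -540 ≤ i → i ≤ 540 → -540 ≤ j → j ≤ 540 →
      ¬ Within (2 * σ) (flip (r (t₀ + T))) (flip (r t₀) + (i * σ + j * σ, i * σ - j * σ)) →
      ∀ t, t₀ + T ≤ t → flip (r t) - (flip (r t₀) + (i * σ + j * σ, i * σ - j * σ)) ∉ W := by
    intro i j h1 h2 h3 h4 hfar t ht
    -- Reflection exchanges `u` and `v`, hence the two mesh indices.
    obtain ⟨i', j', e⟩ := hidx j i h3 h4 h1 h2
    have e' : (i * σ + j * σ, i * σ - j * σ) = flip (d i' j') := by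
      rw [e]
      ext
      · simp [add_comm]
      · simp
    rw [e', ← flip_add, within_flip] at hfar
    rw [e', ← flip_add, ← flip_sub]
    exact G.reflect.not_mem_of_escapes hr
      (fun x => hT i' j' _ (within_flip_zero.2 (hR x)))
      (fun x t => hesc (Sum.inr (false, i', j', x)) t) hfar ht
  intro t ht
  constructor
  · have := hW.confine hσ hr.reflect (a := flip (r t₀)) (t₁ := t₀ + T) (fun s hs => by
      have := (hconf s (by omega)).2
      simp only [flip_fst, flip_snd, ← sub_eq_add_neg]
      omega) (by
      have := (hconf (t₀ + T) (by omega)).1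
      simp only [flip_fst, flip_snd, sub_neg_eq_add]
      omega) hg2 ht
    simpa using this
  · exact hW.confine hσ hr (fun s hs => (hconf s (by omega)).1.trans hρ)
      ((hconf (t₀ + T) (by omega)).2.trans hρ) hg1 ht

/-- At `σ = 8 * 178 ^ k` the old radius is `1068 * σ = 48 * 178 ^ (k + 1)` and the new one `6 * σ =
48 * 178 ^ k`. The cost bound telescopes because `2 * 147 ^ k ≤ 147 ^ (k + 1)`. -/
theorem Confines.descend {n : ℤ} (hn : 0 ≤ n) {J : ℕ} (hJ : 4 * n ≤ 48 * 178 ^ J) {i : ℕ}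
    (hi : i ≤ J) : ∃ m, Confines n (48 * 178 ^ (J - i)) m ∧
      m + 26 * 1081 ^ 2 * 147 ^ (J - i) ≤ 26 * 1081 ^ 2 * 147 ^ J := by
  induction i with
  | zero => exact ⟨0, confines_trivial hJ, by simp⟩
  | succ i ih =>
    obtain ⟨m, hm, hle⟩ := ih (by omega)
    obtain ⟨k, hk⟩ : ∃ k, J - i = k + 1 := ⟨J - i - 1, by omega⟩
    have hk' : J - (i + 1) = k := by omega
    obtain ⟨ι, _, W, cop, rest, G, hW, hc⟩ := exists_guard k
    have h1 : (1 : ℤ) ≤ 178 ^ k := one_le_pow₀ (by norm_num)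
    rw [hk] at hm hle
    rw [hk']
    have h2 := hm.refine hn (σ := 8 * 178 ^ k) (by omega) (by rw [pow_succ]; omega) G hW
    rw [← mul_assoc] at h2
    refine ⟨_, h2, ?_⟩
    rw [hc]
    rw [pow_succ] at hle
    omega

/-! ### The final catch and the transfer to the grid -/

theorem Confines.exists_catch {n ρ : ℤ} {m : ℕ} (hρ : 0 ≤ ρ) (h : Confines n ρ m) :
    ∃ (Ω : Type) (_ : Fintype Ω) (f : Ω → List (ℤ × ℤ) → ℤ × ℤ),
      Fintype.card Ω ≤ m + (2 * ρ.toNat + 1) ^ 2 ∧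
      (∀ i v h, Within 1 (f i h) (f i (v :: h))) ∧
      ∀ r, IsPlay n r → ∃ i t, f i (history r (t + 1)) = r t := by
  obtain ⟨Ω, _, f, t₀, hcard, hlegal, hf⟩ := h
  let d : Fin (2 * ρ.toNat + 1) × Fin (2 * ρ.toNat + 1) → ℤ × ℤ := fun p =>
    ((p.1 : ℤ) - ρ, (p.2 : ℤ) - ρ)
  let T : ℕ := (n + ρ).toNat
  -- One cop walks to each point of the remaining square. The walk lasts `T + 1` moves so that it
  -- ends with the cops' reply to the robber's position at time `t₀ + T`; the guard data `∅ 0 0`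
  -- play no role by then.
  refine ⟨Ω ⊕ (Fin (2 * ρ.toNat + 1) × Fin (2 * ρ.toNat + 1)), inferInstance,
    Sum.elim f (fun p => chase (guardTarget t₀ (T + 1) (d p) ∅ 0 0)), ?_, ?_, ?_⟩
  · simp only [Fintype.card_sum, Fintype.card_prod, Fintype.card_fin]
    rw [← sq]
    omega
  · rintro (i | i) v h
    · exact hlegal i v h
    · exact within_chase _ _ _
  intro r hr
  by_contra! hesc
  obtain ⟨hu, hv⟩ := hf r hr (fun i => hesc (Sum.inl i)) (t₀ + T) (by omega)
  rw [abs_le] at hu hv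
  let p : Fin (2 * ρ.toNat + 1) × Fin (2 * ρ.toNat + 1) :=
    (⟨((r (t₀ + T)).1 - (r t₀).1 + ρ).toNat, by omega⟩,
      ⟨((r (t₀ + T)).2 - (r t₀).2 + ρ).toNat, by omega⟩)
  have hp : r t₀ + d p = r (t₀ + T) := by
    ext
    · simp only [d, p, Prod.fst_add]
      omega
    · simp only [d, p, Prod.snd_add]
      omega
  refine hesc (Sum.inr p) (t₀ + T) ?_
  have h0 : chase (guardTarget t₀ (T + 1) (d p) ∅ 0 0) (history r t₀) = 0 :=
    chase_eq_zero fun s hs => guardTarget_of_lt hs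
  have h1 : chase (guardTarget t₀ (T + 1) (d p) ∅ 0 0) (history r (t₀ + (T + 1))) =
      r t₀ + d p + 0 := by
    refine chase_eq_of_const ?_ fun s hs hs' => guardTarget_of_mem_Ico hs hs'
    have := hr.box (t₀ + T)
    rw [h0, add_zero, hp]
    simp only [within_iff, Prod.fst_zero, Prod.snd_zero, T] at *
    omega
  rwa [add_zero, hp] at h1

/-- A vertex of the grid as a point of `ℤ²`. -/
def toPlane {n : ℕ} (p : Fin n × Fin n) : ℤ × ℤ := (p.1, p.2)

/-- The vertex of the grid that is closest to a point of `ℤ²`. -/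
def toGrid {n : ℕ} (hn : 0 < n) (X : ℤ × ℤ) : Fin n × Fin n :=
  (⟨(min (n - 1 : ℤ) X.1).toNat, by omega⟩, ⟨(min (n - 1 : ℤ) X.2).toNat, by omega⟩)

theorem toGrid_toPlane {n : ℕ} (hn : 0 < n) (p : Fin n × Fin n) : toGrid hn (toPlane p) = p := by
  obtain ⟨a, b⟩ := p
  ext <;> simp only [toGrid, toPlane] <;> omega

/-- Clamping coordinates does not increase distances, so cops may play in the whole plane. -/
theorem toGrid_eq_or_adj {n : ℕ} (hn : 0 < n) {X Y : ℤ × ℤ} (h : Within 1 X Y) :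
    toGrid hn Y = toGrid hn X ∨ (gridGraph n).Adj (toGrid hn X) (toGrid hn Y) := by
  by_cases he : toGrid hn Y = toGrid hn X
  · exact Or.inl he
  · refine Or.inr ⟨fun h' => he h'.symm, ?_⟩
    rw [within_iff] at h
    simp only [toGrid, abs_le]
    omega

theorem within_of_walk {n : ℕ} {p q : Fin n × Fin n} (w : (gridGraph n).Walk p q) :
    Within w.length (toPlane p) (toPlane q) := by
  induction w with
  | nil => simp [Within]
  | cons h w ih =>
    have h1 : Within 1 (toPlane _) (toPlane _) := h.2
    rw [SimpleGraph.Walk.length_cons]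
    refine (h1.trans ih).mono ?_
    push_cast
    omega

theorem within_of_edist_le {n s : ℕ} {p q : Fin n × Fin n}
    (h : (gridGraph n).edist p q ≤ (s : ℕ∞)) : Within s (toPlane p) (toPlane q) := by
  obtain ⟨w, hw⟩ := SimpleGraph.exists_walk_of_edist_ne_top
    (ne_top_of_le_ne_top (ENat.natCast_ne_top s) h)
  refine (within_of_walk w).mono ?_
  rw [← hw] at h
  exact_mod_cast h

theorem IsRobberPlay.isPlay {n : ℕ} {r : ℕ → Fin n × Fin n} (h : IsRobberPlay (gridGraph n) 2 r) :
    IsPlay n (fun t => toPlane (r t)) where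
  step t := within_of_edist_le (h t)
  box t := by
    have h1 := (r t).1.2
    have h2 := (r t).2.2
    simp only [within_iff, toPlane, Prod.fst_zero, Prod.snd_zero]
    omega

theorem Confines.copsCanCatch {n : ℕ} (hn : 0 < n) {ρ : ℤ} {m : ℕ} (hρ : 0 ≤ ρ)
    (h : Confines n ρ m) : ∃ k ≤ m + (2 * ρ.toNat + 1) ^ 2, CopsCanCatch (gridGraph n) 2 k := by
  obtain ⟨Ω, _, f, hcard, hlegal, hf⟩ := h.exists_catch hρ
  let e := Fintype.equivFin Ω
  refine ⟨_, hcard, ⟨fun h i => toGrid hn (f (e.symm i) (h.map toPlane)), fun h v i => ?_⟩,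
    fun r hr => ?_⟩
  · exact toGrid_eq_or_adj hn (hlegal _ _ _)
  · obtain ⟨i, t, hit⟩ := hf _ hr.isPlay
    refine ⟨t, e i, Or.inr ?_⟩
    simp only [Equiv.symm_apply_apply, history_map, hit, toGrid_toPlane]

/-! ### The exponent and the conclusion -/

theorem pow_le_rpow_of_pow_le {J n : ℕ} (h : 178 ^ J ≤ n) :
    (147 : ℝ) ^ J ≤ (n : ℝ) ^ (0.999 : ℝ) := by
  have h1 : (147 : ℝ) ≤ (178 : ℝ) ^ (0.999 : ℝ) := by
    -- `147 ^ 100 ≤ 178 ^ 97` already gives exponent `0.97`.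
    have : ((147 : ℝ) ^ (100 : ℕ)) ^ (1 / 100 : ℝ) ≤ ((178 : ℝ) ^ (97 : ℕ)) ^ (1 / 100 : ℝ) :=
      Real.rpow_le_rpow (by positivity) (by norm_num) (by norm_num)
    rw [← Real.rpow_natCast, ← Real.rpow_natCast, ← Real.rpow_mul (by norm_num),
      ← Real.rpow_mul (by norm_num)] at this
    norm_num at this
    exact this.trans (Real.rpow_le_rpow_of_exponent_le (by norm_num) (by norm_num))
  calc (147 : ℝ) ^ J ≤ ((178 : ℝ) ^ (0.999 : ℝ)) ^ J := by gcongr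
    _ = ((178 : ℝ) ^ J) ^ (0.999 : ℝ) := by
      rw [← Real.rpow_natCast, ← Real.rpow_mul (by norm_num), mul_comm,
        Real.rpow_mul (by norm_num), Real.rpow_natCast]
    _ ≤ (n : ℝ) ^ (0.999 : ℝ) := by
      apply Real.rpow_le_rpow (by positivity) _ (by norm_num)
      exact_mod_cast h

end FastRobber

theorem corollary4p1 :
    ∃ (C : ℝ) (N : ℕ), 0 < C ∧ ∀ n : ℕ, N ≤ n →
      ∃ k : ℕ, (k : ℝ) ≤ C * (n : ℝ) ^ (0.999 : ℝ) ∧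
        FastRobber.CopsCanCatch (gridGraph n) 2 k := by
  -- The factor 147 is due to `J = Nat.log 178 n + 1`, and `97 ^ 2` pays for the last square, of
  -- radius 48.
  refine ⟨26 * 1081 ^ 2 * 147 + 97 ^ 2, 1, by norm_num, fun n hn => ?_⟩
  have h1 : 178 ^ Nat.log 178 n ≤ n := Nat.pow_log_le_self 178 (by omega)
  have h2 : n < 178 ^ (Nat.log 178 n + 1) := Nat.lt_pow_succ_log_self (by norm_num) n
  have h2' : (n : ℤ) < 178 ^ (Nat.log 178 n + 1) := by exact_mod_cast h2
  obtain ⟨m, hm, hle⟩ := FastRobber.Confines.descend (n := n) (by omega)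
    (J := Nat.log 178 n + 1) (by omega) le_rfl
  rw [Nat.sub_self, pow_zero, mul_one] at hm
  obtain ⟨k, hk, hcatch⟩ := hm.copsCanCatch (by omega) (by norm_num)
  refine ⟨k, ?_, hcatch⟩
  have h3 := FastRobber.pow_le_rpow_of_pow_le h1
  have h4 : (1 : ℝ) ≤ (n : ℝ) ^ (0.999 : ℝ) :=
    Real.one_le_rpow (by exact_mod_cast hn) (by norm_num)
  have h5 : k ≤ 26 * 1081 ^ 2 * 147 * 147 ^ Nat.log 178 n + 97 ^ 2 := by
    have : (2 * (48 : ℤ).toNat + 1) ^ 2 = 97 ^ 2 := rfl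
    rw [pow_succ] at hle
    omega
  have h6 : (k : ℝ) ≤ 26 * 1081 ^ 2 * 147 * 147 ^ Nat.log 178 n + 97 ^ 2 := by exact_mod_cast h5
  linarith
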